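/- Let $A\to B$ be a ring homomorphism and let $W$ be the set of all finite matrices with entries in $A$ whose image in $B$ is invertible (i.e. has a two-sided inverse). The Cohn localization $L(A\to B)$ is the ring $\Lambda$, equipped with a ring homomorphism $\iota:A\to\Lambda$, characterized by the following: every matrix in $W$ becomes invertible over $\Lambda$, and every ring homomorphism $g:A\to S$ that makes all matrices in $W$ invertible factors uniquely as $g=h\circ\iota$ with $h:\Lambda\to S$ a ring homomorphism. (Rings are associative and unital, and ring homomorphisms preserve $1$.) **Theorem A.** Let $G$ be a finite group. For every prime $p$, denote by $G_p$ the quotient of $G$ by the subgroup generated by all the elements of $G$ of order coprime to $p$, by $\mathbf{Z}_{(p)}$ the localization of $\mathbf{Z}$ at the prime ideal $(p)$, and by $\varepsilon_p:\mathbf{Z}_{(p)}[G_p]\to\mathbf{Z}_{(p)}$ the augmentation map. Let $\varepsilon:\mathbf{Z}[G]\to\mathbf{Z}$ be the augmentation map. Then the Cohn localization ring $\Lambda=L(\mathbf{Z}[G]\xrightarrow{\varepsilon}\mathbf{Z})$ is given by the pull-back diagram $$\begin{array}{ccc}\Lambda&\longrightarrow&\prod_p\mathbf{Z}_{(p)}[G_p]\\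 \downarrow&&\downarrow{\scriptstyle\prod_p\varepsilon_p}\\ \mathbf{Z}&\xrightarrow{\ \Delta\ }&\prod_p\mathbf{Z}_{(p)}\end{array}$$ where $\Delta$ is the diagonal map and the products are over all primes $p$ with $G_p$ non-trivial. More precisely, the ring of pairs $(n,(x_p)_p)\in\mathbf{Z}\times\prod_p\mathbf{Z}_{(p)}[G_p]$ with $\varepsilon_p(x_p)=n$ for all these $p$, together with the ring homomorphism from $\mathbf{Z}[G]$ to it induced by $\varepsilon$ and by the canonical maps $\mathbf{Z}[G]\to\mathbf{Z}_{(p)}[G_p]$, is the Cohn localization $L(\mathbf{Z}[G]\to\mathbf{Z})$. -/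

import Mathlib

namespace Cohn

section MatrixLocalization

/-- A (possibly rectangular) matrix over a ring is invertible if it has a two-sided inverse. -/
def MatInvertible {R : Type*} [Ring R] {m n : ℕ} (M : Matrix (Fin m) (Fin n) R) : Prop :=
  ∃ N : Matrix (Fin n) (Fin m) R, M * N = 1 ∧ N * M = 1

/-- A set of finite matrices, of arbitrary sizes, with entries in `A`. -/
abbrev MatSet (A : Type*) : Type _ := ∀ m n : ℕ, Set (Matrix (Fin m) (Fin n) A)

/-- Every matrix of `W` becomes invertible under the ring homomorphism `g`. -/
def Inverts {A S : Type*} [Ring A] [Ring S] (W : MatSet A) (g : A →+* S) : Prop :=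
  ∀ (m n : ℕ), ∀ M ∈ W m n, MatInvertible (M.map g)

/-- `ι : A →+* Λ` is the Cohn localization of `A` with respect to the set of matrices `W`:
it inverts all matrices in `W` and is universal with this property. The universe `w` of the rings
against which universality is tested is a parameter. -/
structure IsCohnLocalization.{u, v, w} {A : Type u} {Λ : Type v} [Ring A] [Ring Λ]
    (W : MatSet A) (ι : A →+* Λ) : Prop where
  inverts : Inverts W ι
  universal : ∀ (S : Type w) [Ring S] (g : A →+* S), Inverts W g →
    ∃! h : Λ →+* S, h.comp ι = g

/-- The set of all matrices with entries in `A` which become invertible in `B`. -/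
def invertedBy {A B : Type*} [Ring A] [Ring B] (f : A →+* B) : MatSet A :=
  fun _ _ => {M | MatInvertible (M.map f)}

end MatrixLocalization

noncomputable section Groups

/-- The augmentation map `R[H] → R`, sending every element of `H` to `1`. -/
def augmentation (R H : Type*) [CommRing R] [Group H] : MonoidAlgebra R H →+* R :=
  (MonoidAlgebra.lift R R H (1 : H →* R)).toRingHom

instance isPrime_span (p : Nat.Primes) : (Ideal.span {((p : ℕ) : ℤ)}).IsPrime :=
  (Ideal.span_singleton_prime (by exact_mod_cast p.2.ne_zero)).2
    (Nat.prime_iff_prime_int.1 p.2)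

/-- The ring `ℤ_(p)`: the integers localized at the prime ideal `(p)`. -/
abbrev ZLoc (p : Nat.Primes) : Type := Localization.AtPrime (Ideal.span {((p : ℕ) : ℤ)})

variable (G : Type*) [Group G]

/-- The subgroup of `G` generated by all the elements of order coprime to `p`. -/
def coprimeSubgroup (p : Nat.Primes) : Subgroup G :=
  Subgroup.closure {g : G | (orderOf g).Coprime (p : ℕ)}

instance coprimeSubgroup_normal (p : Nat.Primes) : (coprimeSubgroup G p).Normal := by
  constructor
  intro n hn g
  induction hn using Subgroup.closure_induction with
  | mem x hx =>
    refine Subgroup.subset_closure ?_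
    have h : SemiconjBy g x (g * x * g⁻¹) := by simp [SemiconjBy]
    show (orderOf (g * x * g⁻¹)).Coprime (p : ℕ)
    rw [← h.orderOf_eq]
    exact hx
  | one => simp
  | mul x y _ _ hx hy =>
    have h : g * (x * y) * g⁻¹ = (g * x * g⁻¹) * (g * y * g⁻¹) := by group
    rw [h]
    exact (coprimeSubgroup G p).mul_mem hx hy
  | inv x _ hx =>
    have h : g * x⁻¹ * g⁻¹ = (g * x * g⁻¹)⁻¹ := by group
    rw [h]
    exact (coprimeSubgroup G p).inv_mem hx

/-- The group `G_p`. -/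
abbrev Quot_p (p : Nat.Primes) : Type _ := G ⧸ coprimeSubgroup G p

/-- The primes `p` for which `G_p` is non-trivial. -/
abbrev PrimeIndex : Type := {p : Nat.Primes // Nontrivial (Quot_p G p)}

/-- The diagonal map `Δ : ℤ → ∏ ℤ_(p)`. -/
def diagonal : ℤ →+* (∀ p : PrimeIndex G, ZLoc p.1) :=
  RingHom.pi fun p => algebraMap ℤ (ZLoc p.1)

/-- The product of the augmentation maps `ε_p : ℤ_(p)[G_p] → ℤ_(p)`. -/
def prodAugmentation :
    (∀ p : PrimeIndex G, MonoidAlgebra (ZLoc p.1) (Quot_p G p.1)) →+*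
      (∀ p : PrimeIndex G, ZLoc p.1) :=
  RingHom.pi fun p => (augmentation (ZLoc p.1) (Quot_p G p.1)).comp
    (Pi.evalRingHom (fun p : PrimeIndex G => MonoidAlgebra (ZLoc p.1) (Quot_p G p.1)) p)

/-- The pullback of `∏ ε_p` and `Δ`, as the ring of pairs with the same image in `∏ ℤ_(p)`. -/
def pullbackRing :
    Subring (ℤ × (∀ p : PrimeIndex G, MonoidAlgebra (ZLoc p.1) (Quot_p G p.1))) :=
  RingHom.eqLocus ((diagonal G).comp (RingHom.fst _ _))
    ((prodAugmentation G).comp (RingHom.snd _ _))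

/-- The canonical map `ℤ[G] → ℤ_(p)[G_p]`, induced by `ℤ → ℤ_(p)` and `G → G_p`. -/
def toLocal (p : Nat.Primes) : MonoidAlgebra ℤ G →+* MonoidAlgebra (ZLoc p) (Quot_p G p) :=
  (MonoidAlgebra.mapRingHom (Quot_p G p) (algebraMap ℤ (ZLoc p))).comp
    (MonoidAlgebra.mapDomainRingHom ℤ (QuotientGroup.mk' (coprimeSubgroup G p)))

theorem augmentation_toLocal (p : Nat.Primes) (x : MonoidAlgebra ℤ G) :
    augmentation (ZLoc p) (Quot_p G p) (toLocal G p x) =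
      algebraMap ℤ (ZLoc p) (augmentation ℤ G x) := by
  induction x using MonoidAlgebra.induction_linear with
  | zero => simp
  | add a b ha hb => simp only [map_add, ha, hb]
  | single g r => simp [augmentation, toLocal]

/-- The canonical map from `ℤ[G]` to the pullback, given by the augmentation `ℤ[G] → ℤ` and
the maps `ℤ[G] → ℤ_(p)[G_p]`. -/
def toPullback : MonoidAlgebra ℤ G →+* pullbackRing G :=
  ((augmentation ℤ G).prod (RingHom.pi fun p : PrimeIndex G => toLocal G p.1)).codRestrict
    (pullbackRing G) (fun x => by
      show diagonal G (augmentation ℤ G x) =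
        prodAugmentation G (fun p : PrimeIndex G => toLocal G p.1 x)
      funext p
      exact (augmentation_toLocal G p.1 x).symm)

end Groups

end Cohn

universe u w

/-!
Write `A = ℤ[G]`, let `I` be its augmentation ideal and `P` the pullback ring.

*The map `A → P` inverts the matrices with invertible augmentation.* An inverse over `P` is a family
of inverses over `ℤ` and over the `ℤ_(p)[G_p]`, compatible by uniqueness of inverses. As `G_p` is a
`p`-group, a matrix over `𝔽_p[G_p]` with invertible augmentation is injective
(`mulVec_eq_zero_of_isUnit_augmentation`: otherwise the `p`-group `G_p` has a nonzero fixed vector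
in the kernel), and Nakayama's lemma lifts the inverse to `ℤ_(p)[G_p]`
(`isUnit_map_of_isUnit_augmentation`).

*Universality.* Let `φ : A → S` invert these matrices. If `V` is an additive subgroup of `A` with
`V ⊆ I V`, then `φ` kills `V` (`map_eq_zero_of_le_augKer_mul`), because generators `v` of `V` satisfy
`(1 - a) v = 0` with `1 - a` of augmentation `1`. Hence, in `S`, a normal subgroup `D` commutes with
the elements of order coprime to `|D|` (`commute_of_coprime_card`), and perfect groups become
trivial. By induction on the order, the image `H` of `G` in `S` is nilpotent
(`isNilpotent_of_injective`), so it is the product of its Sylow subgroups `H_p`, and `G → H_p`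
factors through `G_p`. For commuting elements `g`, `h` of coprime orders `(1 - g)(1 - h)` dies in
`S`, so that `1 - g` is the sum of the `1 - g_p`, and `φ` is, up to multiples of the augmentation, a
sum of maps that factor through the `ℤ[G_p]`. So `φ` kills the kernel of `A → P`
(`map_eq_zero_of_toPullback_eq_zero`).

Finally `P` is a ring of fractions of the image of `A`, with denominators that are central in `P`
and have augmentation `1` (`exists_fraction`): the denominators at `p` are `u m + v N`, where `N` is
the norm element of `ℤ[G_p]`, `m` is prime to `p` and `u m + v |G_p| = 1`. As `φ` kills the kernel
and inverts the denominators, it extends uniquely to `P` (`existsUnique_extension`).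
-/

namespace Cohn

open MonoidAlgebra
open scoped Matrix

/-! ### The augmentation ideal -/

section Augmentation

variable {G : Type*} [Group G]

@[simp]
theorem augmentation_single {R : Type*} [CommRing R] (g : G) (r : R) :
    augmentation R G (single g r) = r := by
  simp [augmentation]

@[simp]
theorem augmentation_of {R : Type*} [CommRing R] (g : G) :
    augmentation R G (of R G g) = 1 := by
  simp [of_apply]

variable (G) in
/-- The augmentation ideal of `ℤ[G]`, as an additive group, so that it can be multiplied with
other additive subgroups of `ℤ[G]`. -/
noncomputable def augKer : Submodule ℤ (MonoidAlgebra ℤ G) :=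
  LinearMap.ker (augmentation ℤ G).toAddMonoidHom.toIntLinearMap

theorem mem_augKer {a : MonoidAlgebra ℤ G} : a ∈ augKer G ↔ augmentation ℤ G a = 0 := Iff.rfl

theorem one_sub_of_mem_augKer (g : G) : 1 - of ℤ G g ∈ augKer G := by
  simp [mem_augKer]

theorem augKer_eq_span :
    augKer G = Submodule.span ℤ (Set.range fun g : G => 1 - of ℤ G g) := by
  apply le_antisymm
  · have key : ∀ a : MonoidAlgebra ℤ G, a - (augmentation ℤ G a : ℤ) • (1 : MonoidAlgebra ℤ G) ∈
        Submodule.span ℤ (Set.range fun g : G => 1 - of ℤ G g) := by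
      intro a
      induction a using MonoidAlgebra.induction_linear with
      | zero => simp
      | add a b ha hb =>
        have := add_mem ha hb
        rwa [← add_sub_add_comm, ← add_smul, ← map_add] at this
      | single g r =>
        have h : single g r - (augmentation ℤ G (single g r) : ℤ) • (1 : MonoidAlgebra ℤ G)
            = (-r) • (1 - of ℤ G g) := by
          rw [augmentation_single, neg_smul, smul_sub, of_apply, smul_single]
          simp
        rw [h]
        exact Submodule.smul_mem _ _ (Submodule.subset_span ⟨g, rfl⟩)
    intro a ha
    have := key a
    rwa [mem_augKer.1 ha, zero_smul, sub_zero] at this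
  · rw [Submodule.span_le]
    rintro _ ⟨g, rfl⟩
    exact one_sub_of_mem_augKer g

end Augmentation

/-! ### Nakayama's lemma for homomorphisms that invert matrices -/

section Nakayama

theorem matInvertible_one {R : Type*} [Ring R] (n : ℕ) :
    MatInvertible (1 : Matrix (Fin n) (Fin n) R) :=
  ⟨1, by simp, by simp⟩

theorem isUnit_iff_matInvertible {R : Type*} [Ring R] {n : ℕ} {M : Matrix (Fin n) (Fin n) R} :
    IsUnit M ↔ MatInvertible M := isUnit_iff_exists

theorem isUnit_map_of_augmentation_eq_one {G S : Type*} [Group G] [Ring S]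
    {φ : MonoidAlgebra ℤ G →+* S} (hφ : Inverts (invertedBy (augmentation ℤ G)) φ)
    {s : MonoidAlgebra ℤ G} (hs : augmentation ℤ G s = 1) : IsUnit (φ s) := by
  obtain ⟨N, hN1, hN2⟩ := hφ 1 1 (Matrix.of fun _ _ => s) (by
    show MatInvertible _
    have : (Matrix.of fun _ _ => s : Matrix (Fin 1) (Fin 1) _).map (augmentation ℤ G) = 1 := by
      ext i j
      simp only [Matrix.map_apply, Matrix.of_apply, hs]
      rw [Subsingleton.elim i j, Matrix.one_apply_eq]
    rw [this]
    exact matInvertible_one 1)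
  refine isUnit_iff_exists.2 ⟨N 0 0, ?_, ?_⟩
  · simpa [Matrix.mul_apply] using congrFun (congrFun hN1 0) 0
  · simpa [Matrix.mul_apply] using congrFun (congrFun hN2 0) 0

variable {G : Type*} [Group G] [Finite G] {S : Type*} [Ring S] {φ : MonoidAlgebra ℤ G →+* S}

/-- Nakayama's lemma for Cohn localization. If `v` generates `V` then `v = a v` for a matrix `a`
over the augmentation ideal, and `1 - a` becomes invertible. -/
theorem map_eq_zero_of_le_augKer_mul (hφ : Inverts (invertedBy (augmentation ℤ G)) φ)
    {V : Submodule ℤ (MonoidAlgebra ℤ G)} (hV : V ≤ augKer G * V) :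
    ∀ x ∈ V, φ x = 0 := by
  obtain ⟨n, v, hv⟩ := Submodule.fg_iff_exists_fin_generating_family.1
    (IsNoetherian.noetherian V)
  have hvV : ∀ i, v i ∈ V := fun i => hv ▸ Submodule.subset_span ⟨i, rfl⟩
  have key : ∀ x ∈ augKer G * V, ∃ a : Fin n → MonoidAlgebra ℤ G,
      (∀ j, augmentation ℤ G (a j) = 0) ∧ x = ∑ j, a j * v j := by
    intro x hx
    refine Submodule.mul_induction_on hx (fun m hm w hw => ?_) (fun x y hx hy => ?_)
    · rw [← hv, Submodule.mem_span_range_iff_exists_fun] at hw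
      obtain ⟨c, rfl⟩ := hw
      refine ⟨fun j => c j • m, fun j => ?_, ?_⟩
      · rw [map_zsmul, mem_augKer.1 hm, smul_zero]
      · simp only [Finset.mul_sum, mul_smul_comm, smul_mul_assoc]
    · obtain ⟨a, ha, rfl⟩ := hx
      obtain ⟨b, hb, rfl⟩ := hy
      exact ⟨a + b, fun j => by simp [ha, hb], by simp [add_mul, Finset.sum_add_distrib]⟩
  choose a ha hav using fun i => key _ (hV (hvV i))
  have hM : (1 - Matrix.of a).map (augmentation ℤ G) = 1 := by
    ext i j
    simp [Matrix.one_apply, ha, apply_ite]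
  obtain ⟨N, -, hN⟩ := hφ n n (1 - Matrix.of a) (by
    show MatInvertible _
    rw [hM]
    exact matInvertible_one n)
  have hz : (1 - Matrix.of a).map φ *ᵥ (fun j => φ (v j)) = 0 := by
    have : (1 - Matrix.of a) *ᵥ v = 0 := by
      rw [Matrix.sub_mulVec, Matrix.one_mulVec]
      ext1 i
      rw [Pi.sub_apply, Pi.zero_apply, sub_eq_zero]
      exact hav i
    ext1 i
    have h := congrArg φ (congrFun this i)
    rw [RingHom.map_mulVec] at h
    simpa [Function.comp_def] using h
  have hv0 : (fun j => φ (v j)) = 0 := by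
    rw [← Matrix.one_mulVec (fun j => φ (v j)), ← hN, ← Matrix.mulVec_mulVec, hz,
      Matrix.mulVec_zero]
  intro x hx
  rw [← hv, Submodule.mem_span_range_iff_exists_fun] at hx
  obtain ⟨c, rfl⟩ := hx
  simp only [map_sum, map_zsmul]
  exact Finset.sum_eq_zero fun i _ => by rw [congrFun hv0 i, Pi.zero_apply, smul_zero]

/-- The version of `map_eq_zero_of_le_augKer_mul` for multiplication on the right. -/
theorem map_eq_zero_of_le_mul_augKer (hφ : Inverts (invertedBy (augmentation ℤ G)) φ)
    {V : Submodule ℤ (MonoidAlgebra ℤ G)} (hV : V ≤ V * augKer G) :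
    ∀ x ∈ V, φ x = 0 := by
  obtain ⟨n, v, hv⟩ := Submodule.fg_iff_exists_fin_generating_family.1
    (IsNoetherian.noetherian V)
  have hvV : ∀ i, v i ∈ V := fun i => hv ▸ Submodule.subset_span ⟨i, rfl⟩
  have key : ∀ x ∈ V * augKer G, ∃ a : Fin n → MonoidAlgebra ℤ G,
      (∀ j, augmentation ℤ G (a j) = 0) ∧ x = ∑ j, v j * a j := by
    intro x hx
    refine Submodule.mul_induction_on hx (fun w hw m hm => ?_) (fun x y hx hy => ?_)
    · rw [← hv, Submodule.mem_span_range_iff_exists_fun] at hw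
      obtain ⟨c, rfl⟩ := hw
      refine ⟨fun j => c j • m, fun j => ?_, ?_⟩
      · rw [map_zsmul, mem_augKer.1 hm, smul_zero]
      · simp only [Finset.sum_mul, mul_smul_comm, smul_mul_assoc]
    · obtain ⟨a, ha, rfl⟩ := hx
      obtain ⟨b, hb, rfl⟩ := hy
      exact ⟨a + b, fun j => by simp [ha, hb], by simp [mul_add, Finset.sum_add_distrib]⟩
  choose a ha hav using fun i => key _ (hV (hvV i))
  have hM : (1 - (Matrix.of a)ᵀ).map (augmentation ℤ G) = 1 := by
    ext i j
    simp [Matrix.one_apply, ha, apply_ite]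
  obtain ⟨N, hN, -⟩ := hφ n n (1 - (Matrix.of a)ᵀ) (by
    show MatInvertible _
    rw [hM]
    exact matInvertible_one n)
  have hz : (fun j => φ (v j)) ᵥ* (1 - (Matrix.of a)ᵀ).map φ = 0 := by
    have : v ᵥ* (1 - (Matrix.of a)ᵀ) = 0 := by
      rw [Matrix.vecMul_sub, Matrix.vecMul_one]
      ext1 i
      rw [Pi.sub_apply, Pi.zero_apply, sub_eq_zero]
      exact hav i
    ext1 i
    have h := congrArg φ (congrFun this i)
    rw [RingHom.map_vecMul] at h
    simpa [Function.comp_def] using h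
  have hv0 : (fun j => φ (v j)) = 0 := by
    rw [← Matrix.vecMul_one (fun j => φ (v j)), ← hN, ← Matrix.vecMul_vecMul, hz,
      Matrix.zero_vecMul]
  intro x hx
  rw [← hv, Submodule.mem_span_range_iff_exists_fun] at hx
  obtain ⟨c, rfl⟩ := hx
  simp only [map_sum, map_zsmul]
  exact Finset.sum_eq_zero fun i _ => by rw [congrFun hv0 i, Pi.zero_apply, smul_zero]

end Nakayama

/-! ### Relations between group elements of coprime order -/

section Commutation

variable {G : Type*} [Group G]

theorem le_of_coprime_smul_mem {M : Type*} [AddCommGroup M] {V W : Submodule ℤ M}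
    {m n : ℕ} (h : m.Coprime n) (hm : ∀ v ∈ V, m • v ∈ W) (hn : ∀ v ∈ V, n • v ∈ W) :
    V ≤ W := by
  intro v hv
  have hb : (1 : ℤ) = m * m.gcdA n + n * m.gcdB n := by
    rw [← Nat.gcd_eq_gcd_ab, Nat.coprime_iff_gcd_eq_one.1 h, Nat.cast_one]
  have : v = m.gcdA n • (m • v) + m.gcdB n • (n • v) := by
    rw [← natCast_zsmul v m, ← natCast_zsmul v n, smul_smul, smul_smul, ← add_smul,
      mul_comm _ (m : ℤ), mul_comm _ (n : ℤ), ← hb, one_smul]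
  rw [this]
  exact add_mem (W.smul_mem _ (hm v hv)) (W.smul_mem _ (hn v hv))

/-- The additive group spanned by the `(1 - x) g` for `x ∈ X` and `g ∈ G`; it is a two-sided ideal
when `X` is closed under conjugation. -/
noncomputable def oneSubSpan (X : Set G) : Submodule ℤ (MonoidAlgebra ℤ G) :=
  Submodule.span ℤ {z | ∃ x ∈ X, ∃ g : G, z = (1 - of ℤ G x) * of ℤ G g}

theorem one_sub_mem_oneSubSpan {X : Set G} {x : G} (hx : x ∈ X) : 1 - of ℤ G x ∈ oneSubSpan X :=
  Submodule.subset_span ⟨x, hx, 1, by rw [map_one, mul_one]⟩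

theorem natCast_sub_sum_mem_augKer {ι : Type*} (s : Finset ι) (f : ι → G) :
    (s.card : MonoidAlgebra ℤ G) - ∑ i ∈ s, of ℤ G (f i) ∈ augKer G := by
  simp [mem_augKer]

/-- `m - (1 + x + ⋯ + x ^ (m - 1))` lies in the augmentation ideal and acts on `1 - x` as
multiplication by `m`. -/
theorem smul_mem_augKer_mul_oneSubSpan (m : ℕ) :
    ∀ l ∈ oneSubSpan {x : G | x ^ m = 1}, m • l ∈ augKer G * oneSubSpan {x : G | x ^ m = 1} := by
  intro l hl
  induction hl using Submodule.span_induction with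
  | zero => simp
  | add a b _ _ ha hb => rw [smul_add]; exact add_mem ha hb
  | smul c a _ ha => rw [smul_comm]; exact Submodule.smul_mem _ _ ha
  | mem z hz =>
    obtain ⟨x, hx, g, rfl⟩ := hz
    have h0 : (∑ i ∈ Finset.range m, of ℤ G (x ^ i)) * (1 - of ℤ G x) = 0 := by
      simp_rw [map_pow]
      rw [geom_sum_mul_neg, ← map_pow, hx, map_one, sub_self]
    have : m • ((1 - of ℤ G x) * of ℤ G g) =
        (((Finset.range m).card : MonoidAlgebra ℤ G) - ∑ i ∈ Finset.range m, of ℤ G (x ^ i)) *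
          ((1 - of ℤ G x) * of ℤ G g) := by
      rw [sub_mul _ _ (_ * _), ← mul_assoc (Finset.sum _ _), h0, zero_mul, sub_zero,
        Finset.card_range, nsmul_eq_mul]
    rw [this]
    exact Submodule.mul_mem_mul (natCast_sub_sum_mem_augKer _ _)
      (Submodule.subset_span ⟨x, hx, g, rfl⟩)

/-- The right-handed version of `smul_mem_augKer_mul_oneSubSpan`, which uses that the span is closed
under conjugation. -/
theorem smul_mem_oneSubSpan_mul_augKer (m : ℕ) :
    ∀ l ∈ oneSubSpan {x : G | x ^ m = 1}, m • l ∈ oneSubSpan {x : G | x ^ m = 1} * augKer G := by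
  intro l hl
  induction hl using Submodule.span_induction with
  | zero => simp
  | add a b _ _ ha hb => rw [smul_add]; exact add_mem ha hb
  | smul c a _ ha => rw [smul_comm]; exact Submodule.smul_mem _ _ ha
  | mem z hz =>
    obtain ⟨x, hx, g, rfl⟩ := hz
    have hx' : (g⁻¹ * x * g) ^ m = 1 := by
      have h := conj_pow (i := m) (a := g⁻¹) (b := x)
      rw [inv_inv, show x ^ m = 1 from hx] at h
      simpa using h
    have hconj : (1 - of ℤ G x) * of ℤ G g = of ℤ G g * (1 - of ℤ G (g⁻¹ * x * g)) := by
      rw [sub_mul, mul_sub, ← map_mul, ← map_mul, one_mul, mul_one]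
      congr 2
      group
    have h0 : (1 - of ℤ G (g⁻¹ * x * g)) *
        (∑ i ∈ Finset.range m, of ℤ G ((g⁻¹ * x * g) ^ i)) = 0 := by
      simp_rw [map_pow (of ℤ G)]
      rw [mul_neg_geom_sum, ← map_pow, hx', map_one, sub_self]
    have : m • ((1 - of ℤ G x) * of ℤ G g) = ((1 - of ℤ G x) * of ℤ G g) *
        (((Finset.range m).card : MonoidAlgebra ℤ G) -
          ∑ i ∈ Finset.range m, of ℤ G ((g⁻¹ * x * g) ^ i)) := by
      rw [mul_sub (_ * _), hconj, mul_assoc _ _ (Finset.sum _ _), h0, mul_zero, sub_zero,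
        Finset.card_range, nsmul_eq_mul, Nat.cast_comm]
    rw [this]
    exact Submodule.mul_mem_mul (Submodule.subset_span ⟨x, hx, g, rfl⟩)
      (natCast_sub_sum_mem_augKer _ _)

/-- For commuting `g` and `h` of coprime orders, a combination of the norms of `g` and
`h` has augmentation `1`, commutes with `g` and `h` and kills `(1 - g)(1 - h)`. -/
theorem map_one_sub_mul_one_sub_eq_zero {S : Type*} [Ring S]
    {φ : MonoidAlgebra ℤ G →+* S} (hφ : Inverts (invertedBy (augmentation ℤ G)) φ)
    {g h : G} (hgh : Commute g h) (hc : (orderOf g).Coprime (orderOf h)) :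
    (1 - φ (of ℤ G g)) * (1 - φ (of ℤ G h)) = 0 := by
  set u := (orderOf g).gcdA (orderOf h)
  set v := (orderOf g).gcdB (orderOf h)
  have hb : (1 : ℤ) = orderOf g * u + orderOf h * v := by
    rw [← Nat.gcd_eq_gcd_ab, Nat.coprime_iff_gcd_eq_one.1 hc, Nat.cast_one]
  set Ng : MonoidAlgebra ℤ G := ∑ i ∈ Finset.range (orderOf g), of ℤ G g ^ i with hNg
  set Nh : MonoidAlgebra ℤ G := ∑ i ∈ Finset.range (orderOf h), of ℤ G h ^ i with hNh
  have hg0 : Ng * (1 - of ℤ G g) = 0 := by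
    rw [hNg, geom_sum_mul_neg, ← map_pow, pow_orderOf_eq_one, map_one, sub_self]
  have hh0 : Nh * (1 - of ℤ G h) = 0 := by
    rw [hNh, geom_sum_mul_neg, ← map_pow, pow_orderOf_eq_one, map_one, sub_self]
  have hcomm : Commute (of ℤ G g) Nh := Commute.sum_right _ _ _ fun i _ =>
    (hgh.map (of ℤ G)).pow_right i
  have hw0 : (u • Ng + v • Nh) * ((1 - of ℤ G g) * (1 - of ℤ G h)) = 0 := by
    rw [add_mul, smul_mul_assoc, smul_mul_assoc, ← mul_assoc, hg0, zero_mul, smul_zero, zero_add,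
      ← mul_assoc, ((Commute.one_left _).sub_left hcomm).symm.eq, mul_assoc, hh0, mul_zero,
      smul_zero]
  have hw1 : augmentation ℤ G (u • Ng + v • Nh) = 1 := by
    rw [hNg, hNh]
    simp only [map_add, map_zsmul, map_sum, map_pow, augmentation_of, one_pow, Finset.sum_const,
      Finset.card_range]
    simpa [mul_comm] using hb.symm
  have hu := isUnit_map_of_augmentation_eq_one hφ hw1
  have h0 := congrArg φ hw0
  rw [map_mul, map_zero] at h0
  have h2 := hu.mul_right_eq_zero.1 h0
  simpa only [map_mul, map_sub, map_one] using h2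

variable [Finite G]

/-- The norm element of a normal subgroup `D` is central and kills `1 - d` for `d ∈ D`. -/
theorem exists_central_norm (D : Subgroup G) [D.Normal] : ∃ N : MonoidAlgebra ℤ G,
    (∀ a, Commute N a) ∧ (Nat.card D : MonoidAlgebra ℤ G) - N ∈ augKer G ∧
      ∀ k ∈ oneSubSpan (D : Set G), N * k = 0 := by
  have := Fintype.ofFinite D
  have hcomm : ∀ a, Commute (∑ d : D, of ℤ G (d : G)) a := by
    intro a
    induction a using MonoidAlgebra.induction_on with
    | of g =>
      show _ * _ = _ * _
      rw [Finset.sum_mul, Finset.mul_sum]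
      refine Fintype.sum_equiv (MulAut.conjNormal (H := D) g⁻¹).toEquiv _ _ fun d => ?_
      rw [← map_mul, ← map_mul]
      congr 1
      simp [mul_assoc]
    | add a b ha hb => exact ha.add_right hb
    | smul r a ha => exact ha.smul_right r
  refine ⟨_, hcomm, ?_, fun k hk => ?_⟩
  · rw [Nat.card_eq_fintype_card]
    exact natCast_sub_sum_mem_augKer _ _
  · induction hk using Submodule.span_induction with
    | zero => simp
    | add a b _ _ ha hb => rw [mul_add, ha, hb, add_zero]
    | smul c a _ ha => rw [mul_smul_comm, ha, smul_zero]
    | mem z hz =>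
      obtain ⟨x, hx, g, rfl⟩ := hz
      rw [← mul_assoc, mul_sub, mul_one, Finset.sum_mul, sub_eq_zero.2, zero_mul]
      refine (Fintype.sum_equiv (Equiv.mulRight (⟨x, hx⟩ : D)) _ _ fun d => ?_).symm
      rw [← map_mul]
      rfl

variable {S : Type*} [Ring S] {φ : MonoidAlgebra ℤ G →+* S}

/-- The products `V` of the ideals of `y` and of `D` satisfy `V = I V` (in one order) and
`V = V I` (in the other), since `V / I V` is killed by the coprime numbers `orderOf y` and `|D|`.
So the images of `1 - y` and `1 - d` have product zero in both orders. -/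
theorem commute_of_coprime_card (hφ : Inverts (invertedBy (augmentation ℤ G)) φ)
    (D : Subgroup G) [D.Normal] {y d : G} (hy : (orderOf y).Coprime (Nat.card D)) (hd : d ∈ D) :
    Commute (φ (of ℤ G y)) (φ (of ℤ G d)) := by
  obtain ⟨N, hNc, hNε, hNk⟩ := exists_central_norm D
  set L := oneSubSpan {x : G | x ^ orderOf y = 1}
  set K := oneSubSpan (D : Set G)
  have hyL : 1 - of ℤ G y ∈ L := one_sub_mem_oneSubSpan (pow_orderOf_eq_one y)
  have hdK : 1 - of ℤ G d ∈ K := one_sub_mem_oneSubSpan hd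
  -- `L` is multiplied into `I L` by the order of `y`; since the norm `N` of `D` is central and
  -- kills `K`, multiplication by `|D|` agrees on `L K` with multiplication by `|D| - N ∈ I`
  have hLK : L * K ≤ augKer G * (L * K) := by
    refine le_of_coprime_smul_mem hy (fun v hv => ?_) (fun v hv => ?_)
    · refine Submodule.mul_induction_on hv (fun l hl k hk => ?_)
        (fun a b ha hb => by rw [smul_add]; exact add_mem ha hb)
      rw [← smul_mul_assoc, ← mul_assoc]
      exact Submodule.mul_mem_mul (smul_mem_augKer_mul_oneSubSpan _ l hl) hk
    · refine Submodule.mul_induction_on hv (fun l hl k hk => ?_)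
        (fun a b ha hb => by rw [smul_add]; exact add_mem ha hb)
      have : Nat.card D • (l * k) = (Nat.card D - N) * (l * k) := by
        rw [sub_mul, ← mul_assoc N, (hNc l).eq, mul_assoc l, hNk k hk, mul_zero, sub_zero,
          nsmul_eq_mul]
      rw [this]
      exact Submodule.mul_mem_mul hNε (Submodule.mul_mem_mul hl hk)
  have hKL : K * L ≤ K * L * augKer G := by
    refine le_of_coprime_smul_mem hy (fun v hv => ?_) (fun v hv => ?_)
    · refine Submodule.mul_induction_on hv (fun k hk l hl => ?_)
        (fun a b ha hb => by rw [smul_add]; exact add_mem ha hb)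
      rw [← mul_smul_comm, mul_assoc]
      exact Submodule.mul_mem_mul hk (smul_mem_oneSubSpan_mul_augKer _ l hl)
    · refine Submodule.mul_induction_on hv (fun k hk l hl => ?_)
        (fun a b ha hb => by rw [smul_add]; exact add_mem ha hb)
      have : Nat.card D • (k * l) = (k * l) * (Nat.card D - N) := by
        rw [mul_sub, ← (hNc _).eq, ← mul_assoc N, hNk k hk, zero_mul, sub_zero,
          nsmul_eq_mul, Nat.cast_comm]
      rw [this]
      exact Submodule.mul_mem_mul (Submodule.mul_mem_mul hk hl) hNε
  have h1 := map_eq_zero_of_le_augKer_mul hφ hLK _ (Submodule.mul_mem_mul hyL hdK)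
  have h2 := map_eq_zero_of_le_mul_augKer hφ hKL _ (Submodule.mul_mem_mul hdK hyL)
  simp only [map_mul, map_sub, map_one] at h1 h2
  have h : (1 - φ (of ℤ G y)) * (1 - φ (of ℤ G d)) = (1 - φ (of ℤ G d)) * (1 - φ (of ℤ G y)) :=
    h1.trans h2.symm
  simp only [sub_mul, mul_sub, one_mul, mul_one] at h
  show φ (of ℤ G y) * φ (of ℤ G d) = φ (of ℤ G d) * φ (of ℤ G y)
  have h' := congrArg (fun t => t - 1 + φ (of ℤ G d) + φ (of ℤ G y)) h
  abel_nf at h'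
  simpa using h'

/-- A perfect group dies in `S`, since its augmentation ideal is idempotent. -/
theorem map_of_eq_one_of_perfect (hφ : Inverts (invertedBy (augmentation ℤ G)) φ)
    (hG : commutator G = ⊤) (g : G) : φ (of ℤ G g) = 1 := by
  have hI : augKer G ≤ augKer G * augKer G := by
    let f : G →* Multiplicative (MonoidAlgebra ℤ G ⧸ (augKer G * augKer G)) :=
      { toFun := fun g => Multiplicative.ofAdd (Submodule.Quotient.mk (1 - of ℤ G g))
        map_one' := by rw [map_one, sub_self]; rfl
        map_mul' := fun a b => by
          rw [← ofAdd_add, ← Submodule.Quotient.mk_add]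
          refine congrArg Multiplicative.ofAdd ((Submodule.Quotient.eq _).2 ?_)
          have : 1 - of ℤ G (a * b) - (1 - of ℤ G a + (1 - of ℤ G b)) =
              - ((1 - of ℤ G a) * (1 - of ℤ G b)) := by
            rw [map_mul]
            noncomm_ring
          rw [this]
          exact neg_mem (Submodule.mul_mem_mul (one_sub_of_mem_augKer a)
            (one_sub_of_mem_augKer b)) }
    rw [augKer_eq_span, Submodule.span_le, ← augKer_eq_span]
    rintro _ ⟨g, rfl⟩
    have hg : g ∈ f.ker := Abelianization.commutator_subset_ker f (hG ▸ Subgroup.mem_top g)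
    exact (Submodule.Quotient.mk_eq_zero _).1 (Multiplicative.ofAdd.injective hg)
  have := map_eq_zero_of_le_augKer_mul hφ hI _ (one_sub_of_mem_augKer g)
  rw [map_sub, map_one, sub_eq_zero] at this
  exact this.symm

end Commutation

/-! ### Change of groups -/

section Functoriality

variable {G H : Type*} [Group G] [Group H] {S : Type*} [Ring S]

theorem augmentation_comp_mapDomainRingHom (f : G →* H) :
    (augmentation ℤ H).comp (mapDomainRingHom ℤ f) = augmentation ℤ G := by
  ext <;> simp

theorem augmentation_mapDomainRingHom (f : G →* H) (x : MonoidAlgebra ℤ G) :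
    augmentation ℤ H (mapDomainRingHom ℤ f x) = augmentation ℤ G x :=
  RingHom.congr_fun (augmentation_comp_mapDomainRingHom f) x

theorem inverts_comp_mapDomainRingHom (f : G →* H) {φ : MonoidAlgebra ℤ H →+* S}
    (hφ : Inverts (invertedBy (augmentation ℤ H)) φ) :
    Inverts (invertedBy (augmentation ℤ G)) (φ.comp (mapDomainRingHom ℤ f)) := by
  intro m n M hM
  have h := hφ m n (M.map (mapDomainRingHom ℤ f)) (by
    show MatInvertible _
    rw [Matrix.map_map, ← RingHom.coe_comp, augmentation_comp_mapDomainRingHom]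
    exact hM)
  rwa [Matrix.map_map, ← RingHom.coe_comp] at h

theorem mapDomainRingHom_surjective {f : G →* H} (hf : Function.Surjective f) :
    Function.Surjective (mapDomainRingHom ℤ f) := by
  intro y
  induction y using MonoidAlgebra.induction_linear with
  | zero => exact ⟨0, map_zero _⟩
  | add a b ha hb =>
    obtain ⟨a, rfl⟩ := ha
    obtain ⟨b, rfl⟩ := hb
    exact ⟨a + b, map_add _ _ _⟩
  | single h r =>
    obtain ⟨g, rfl⟩ := hf h
    exact ⟨single g r, by simp⟩

theorem inverts_of_comp_mapDomainRingHom {f : G →* H} (hf : Function.Surjective f)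
    {φ : MonoidAlgebra ℤ H →+* S}
    (hφ : Inverts (invertedBy (augmentation ℤ G)) (φ.comp (mapDomainRingHom ℤ f))) :
    Inverts (invertedBy (augmentation ℤ H)) φ := by
  intro m n M hM
  choose s hs using mapDomainRingHom_surjective hf
  have hMs : (M.map s).map (mapDomainRingHom ℤ f) = M := by
    ext1 i j
    exact hs _
  have h := hφ m n (M.map s) (by
    show MatInvertible _
    rw [← augmentation_comp_mapDomainRingHom f, RingHom.coe_comp, ← Matrix.map_map, hMs]
    exact hM)
  rwa [RingHom.coe_comp, ← Matrix.map_map, hMs] at h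

end Functoriality

/-! ### Nilpotency of the image of the group -/

section Nilpotent

theorem isNilpotent_iff_forall_sylow_normal {G : Type*} [Group G] [Finite G] :
    Group.IsNilpotent G ↔
      ∀ (p : ℕ) [Fact p.Prime] (P : Sylow p G), (P : Subgroup G).Normal :=
  Group.isNilpotent_of_finite_tfae.out 0 3

theorem eq_top_of_forall_sylow_le {G : Type*} [Group G] [Finite G] (H : Subgroup G)
    (h : ∀ (q : ℕ) [Fact q.Prime], ∃ Q : Sylow q G, (Q : Subgroup G) ≤ H) : H = ⊤ := by
  rw [← Subgroup.index_eq_one]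
  by_contra h1
  obtain ⟨q, hq, hqd⟩ := Nat.exists_prime_and_dvd h1
  have := Fact.mk hq
  obtain ⟨Q, hQ⟩ := h q
  exact Q.not_dvd_index (hqd.trans (Subgroup.index_dvd_of_le hQ))

/-- If `G` is embedded in `S` and `ℤ[G] → S` inverts the matrices with invertible augmentation,
then `G` is nilpotent: the commutator subgroup `N` is proper since a perfect group dies in `S`, so
`N` is nilpotent by induction, and its Sylow subgroups are normal in `G` and hence commute with the
elements of coprime order. -/
theorem isNilpotent_of_injective {S : Type*} [Ring S] (n : ℕ) :
    ∀ (G : Type u) [Group G] [Finite G] (φ : MonoidAlgebra ℤ G →+* S)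
      (_ : Inverts (invertedBy (augmentation ℤ G)) φ)
      (_ : Function.Injective fun g => φ (of ℤ G g)) (_ : Nat.card G = n),
      Group.IsNilpotent G := by
  induction n using Nat.strong_induction_on with
  | _ n ih =>
    intro G _ _ φ hφ hinj hn
    by_cases htop : commutator G = ⊤
    · have : Subsingleton G := ⟨fun a b => hinj (by
        simp only [map_of_eq_one_of_perfect hφ htop])⟩
      infer_instance
    have hcard : Nat.card (commutator G) < n := by
      rw [← hn]
      exact lt_of_not_ge fun h => htop (Subgroup.eq_top_of_le_card _ h)
    have hN : Group.IsNilpotent (commutator G) := by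
      refine ih _ hcard _ _ (inverts_comp_mapDomainRingHom (commutator G).subtype hφ)
        (fun a b hab => ?_) rfl
      exact Subtype.ext (hinj (by simpa using hab))
    refine isNilpotent_iff_forall_sylow_normal.2 fun p hp P => ?_
    have hle : commutator G ≤ Subgroup.normalizer (P : Set G) := by
      rw [← Subgroup.subgroupOf_eq_top]
      refine eq_top_of_forall_sylow_le _ fun q hq => ?_
      obtain ⟨Q⟩ : Nonempty (Sylow q (commutator G)) := inferInstance
      have hQn : (Q : Subgroup (commutator G)).Normal :=
        isNilpotent_iff_forall_sylow_normal.1 hN q Q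
      have hQc := Q.characteristic_of_normal hQn
      have hQG : ((Q : Subgroup (commutator G)).map (commutator G).subtype).Normal :=
        inferInstance
      have hQp : IsPGroup q ((Q : Subgroup (commutator G)).map (commutator G).subtype) :=
        Q.isPGroup'.map _
      refine ⟨Q, fun x hx => ?_⟩
      rw [Subgroup.mem_subgroupOf]
      have hx' : (x : G) ∈ (Q : Subgroup (commutator G)).map (commutator G).subtype :=
        ⟨x, hx, rfl⟩
      by_cases hpq : q = p
      · subst hpq
        exact Subgroup.le_normalizer (hQp.le_sylow_of_normal P hx')
      · have hcent : ∀ g ∈ P, (x : G) * g = g * x := by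
          intro g hg
          have hco : (orderOf g).Coprime
              (Nat.card ((Q : Subgroup (commutator G)).map (commutator G).subtype)) := by
            obtain ⟨a, ha⟩ := IsPGroup.iff_orderOf.1 P.isPGroup' ⟨g, hg⟩
            obtain ⟨b, hb⟩ := IsPGroup.iff_card.1 hQp
            rw [Subgroup.orderOf_mk] at ha
            rw [ha, hb]
            exact ((Nat.coprime_primes hp.out hq.out).2 (Ne.symm hpq)).pow a b
          have := commute_of_coprime_card hφ _ hco hx'
          refine hinj ?_
          simp only [map_mul]
          exact this.eq.symm
        exact Subgroup.centralizer_le_normalizer _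
          (Subgroup.mem_centralizer_iff.2 fun g hg => (hcent g hg).symm)
    exact P.normal_of_normalizer_normal (Subgroup.Normal.of_commutator_le G hle)

end Nilpotent

/-! ### The kernel of the map to the pullback -/

section Kernel

variable {G : Type*} [Group G] {S : Type*} [Ring S]

/-- In a nilpotent group every element `g` is a product of commuting elements `π p g` of `p`-power
order, where the `π p` are endomorphisms, and then the image of `1 - g` in `S` is the sum of those of the
`1 - π p g`. -/
theorem exists_primary_endomorphisms [Finite G] {φ : MonoidAlgebra ℤ G →+* S}
    (hφ : Inverts (invertedBy (augmentation ℤ G)) φ) (hG : Group.IsNilpotent G) :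
    ∃ π : (Nat.card G).primeFactors → G →* G,
      (∀ p g, ∃ k, orderOf (π p g) ∣ (p : ℕ) ^ k) ∧
      ∀ g, 1 - φ (of ℤ G g) = ∑ p, (1 - φ (of ℤ G (π p g))) := by
  classical
  have hn := isNilpotent_iff_forall_sylow_normal.1 hG
  let f := Sylow.directProductOfNormal (G := G) fun {p} hp P => hn p P
  let X : (Nat.card G).primeFactors → Type _ := fun p => ∀ P : Sylow (p : ℕ) G, P
  let π : (Nat.card G).primeFactors → G →* G := fun p =>
    f.toMonoidHom.comp (((MonoidHom.mulSingle X p).comp (Pi.evalMonoidHom X p)).comp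
      f.symm.toMonoidHom)
  have hπ : ∀ p g, π p g = f (Pi.mulSingle p (f.symm g p)) := fun p g => rfl
  have hord : ∀ p g, ∃ k, orderOf (π p g) ∣ (p : ℕ) ^ k := by
    intro p g
    have := Fact.mk (Nat.prime_of_mem_primeFactors p.2)
    refine ⟨(Nat.card G).factorization p, orderOf_dvd_of_pow_eq_one ?_⟩
    rw [hπ, ← map_pow, ← Pi.mulSingle_pow]
    have : f.symm g p ^ (p : ℕ) ^ (Nat.card G).factorization p = 1 := by
      ext1 P
      rw [Pi.pow_apply, ← P.card_eq_multiplicity]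
      exact pow_card_eq_one'
    rw [this, Pi.mulSingle_one, map_one]
  refine ⟨π, hord, fun g => ?_⟩
  have horth : ∀ p q, p ≠ q → (1 - φ (of ℤ G (π p g))) * (1 - φ (of ℤ G (π q g))) = 0 := by
    intro p q hpq
    refine map_one_sub_mul_one_sub_eq_zero hφ ?_ ?_
    · rw [hπ, hπ]
      exact (Pi.mulSingle_commute (f := X) hpq _ _).map f
    · obtain ⟨a, ha⟩ := hord p g
      obtain ⟨b, hb⟩ := hord q g
      exact (((Nat.coprime_primes (Nat.prime_of_mem_primeFactors p.2)
        (Nat.prime_of_mem_primeFactors q.2)).2 (fun h => hpq (Subtype.ext h))).pow a b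
        |>.coprime_dvd_left ha).coprime_dvd_right hb
  have key : ∀ s : Finset (Nat.card G).primeFactors,
      1 - φ (of ℤ G (f (fun p => if p ∈ s then f.symm g p else 1))) =
        ∑ p ∈ s, (1 - φ (of ℤ G (π p g))) := by
    intro s
    induction s using Finset.induction_on with
    | empty =>
      have : (fun p : (Nat.card G).primeFactors =>
          if p ∈ (∅ : Finset _) then f.symm g p else 1) = 1 := by
        ext1 p
        simp
      rw [this, map_one, map_one, map_one, sub_self, Finset.sum_empty]
    | insert p s hp ih =>
      have hsplit : (fun q => if q ∈ insert p s then f.symm g q else 1) =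
          Pi.mulSingle p (f.symm g p) * (fun q => if q ∈ s then f.symm g q else 1) := by
        ext1 q
        by_cases hq : q = p
        · subst hq
          simp [hp]
        · simp [hq]
      rw [Finset.sum_insert hp, ← ih, hsplit, map_mul, map_mul, map_mul, ← hπ]
      have h0 : (1 - φ (of ℤ G (π p g))) *
          (1 - φ (of ℤ G (f (fun p => if p ∈ s then f.symm g p else 1)))) = 0 := by
        rw [ih, Finset.mul_sum]
        exact Finset.sum_eq_zero fun q hq => horth p q (by rintro rfl; exact hp hq)
      rw [← sub_eq_zero, ← neg_eq_zero, ← h0]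
      noncomm_ring
  have := key Finset.univ
  simp only [Finset.mem_univ, if_true] at this
  rw [← this]
  congr 3
  exact (f.apply_symm_apply g).symm

theorem eq_zero_of_subsingleton [Subsingleton G] {x : MonoidAlgebra ℤ G}
    (hx : augmentation ℤ G x = 0) : x = 0 := by
  have : ∀ y : MonoidAlgebra ℤ G, y = single 1 (augmentation ℤ G y) := by
    intro y
    induction y using MonoidAlgebra.induction_linear with
    | zero => simp
    | add a b ha hb => rw [map_add, single_add, ← ha, ← hb]
    | single g r => rw [augmentation_single, Subsingleton.elim g 1]
  rw [this x, hx, single_zero]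

theorem algebraMap_zLoc_injective (p : Nat.Primes) :
    Function.Injective (algebraMap ℤ (ZLoc p)) :=
  IsLocalization.injective (ZLoc p)
    (Ideal.primeCompl_le_nonZeroDivisors (Ideal.span {((p : ℕ) : ℤ)}))

/-- The kernel of the map to the pullback dies in `ℤ[G_p]` for all `p`; for trivial `G_p`, which do
not occur in the pullback, this holds because the augmentation vanishes. -/
theorem mapDomain_mk_eq_zero_of_toPullback_eq_zero {x : MonoidAlgebra ℤ G}
    (hx : toPullback G x = 0) (p : Nat.Primes) :
    mapDomainRingHom ℤ (QuotientGroup.mk' (coprimeSubgroup G p)) x = 0 := by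
  have hx' := congrArg Subtype.val hx
  by_cases hp : Nontrivial (Quot_p G p)
  · have h2 : toLocal G p x = 0 := congrFun (congrArg Prod.snd hx') ⟨p, hp⟩
    exact MonoidAlgebra.map_injective _ (algebraMap_zLoc_injective p)
      (h2.trans (MonoidAlgebra.map_zero _).symm)
  · have := not_nontrivial_iff_subsingleton.1 hp
    have h1 : augmentation ℤ G x = 0 := congrArg Prod.fst hx'
    exact eq_zero_of_subsingleton ((augmentation_mapDomainRingHom _ x).trans h1)

/-- A ring homomorphism that inverts the matrices with invertible augmentation kills the kernel of
the canonical map to the pullback: it is a sum of maps that factor through the `ℤ[G_p]`. -/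
theorem map_eq_zero_of_toPullback_eq_zero [Finite G] {φ : MonoidAlgebra ℤ G →+* S}
    (hφ : Inverts (invertedBy (augmentation ℤ G)) φ) {x : MonoidAlgebra ℤ G}
    (hx : toPullback G x = 0) : φ x = 0 := by
  let θ : G →* S := (φ : MonoidAlgebra ℤ G →* S).comp (of ℤ G)
  -- `H` is the image of `G` in `S`
  let H := G ⧸ θ.ker
  let ψ : H →* S := QuotientGroup.lift θ.ker θ fun g hg => hg
  let ψ' : MonoidAlgebra ℤ H →+* S := (MonoidAlgebra.lift ℤ S H ψ).toRingHom
  have hψ' : ∀ h, ψ' (of ℤ H h) = ψ h := fun h => by simp [ψ']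
  have hcomp : ψ'.comp (mapDomainRingHom ℤ (QuotientGroup.mk' θ.ker)) = φ := by
    refine MonoidAlgebra.ringHom_ext (fun r => ?_) (fun g => ?_)
    · exact RingHom.congr_fun (RingHom.ext_int
        ((ψ'.comp (mapDomainRingHom ℤ (QuotientGroup.mk' θ.ker))).comp singleOneRingHom)
        (φ.comp singleOneRingHom)) r
    · have h1 : (ψ'.comp (mapDomainRingHom ℤ (QuotientGroup.mk' θ.ker))) (single g 1) =
          ψ' (of ℤ H (g : H)) := by simp [of_apply, H]
      rw [h1, hψ']
      rfl
  have hinv : Inverts (invertedBy (augmentation ℤ H)) ψ' :=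
    inverts_of_comp_mapDomainRingHom (QuotientGroup.mk'_surjective _) (by rwa [hcomp])
  have hinj : Function.Injective fun h => ψ' (of ℤ H h) := by
    simp only [hψ']
    intro a b
    induction a, b using Quotient.inductionOn₂' with
    | h a b =>
      intro hab
      refine QuotientGroup.eq.2 (MonoidHom.mem_ker.2 ?_)
      have hab' : θ a = θ b := hab
      rw [map_mul, ← hab', ← map_mul, inv_mul_cancel, map_one]
  have hnil : Group.IsNilpotent H := isNilpotent_of_injective _ H ψ' hinv hinj rfl
  obtain ⟨π, hπ, hsum⟩ := exists_primary_endomorphisms hinv hnil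
  let P : (Nat.card H).primeFactors → Nat.Primes := fun p =>
    ⟨p, Nat.prime_of_mem_primeFactors p.2⟩
  have hker : ∀ p, coprimeSubgroup G (P p) ≤ ((π p).comp (QuotientGroup.mk' θ.ker)).ker := by
    intro p
    rw [coprimeSubgroup, Subgroup.closure_le]
    intro g hg
    obtain ⟨k, hk⟩ := hπ p (g : H)
    have h1 : orderOf (π p (g : H)) ∣ orderOf g :=
      orderOf_map_dvd ((π p).comp (QuotientGroup.mk' θ.ker)) g
    have h2 : orderOf (π p (g : H)) = 1 :=
      Nat.eq_one_of_dvd_coprimes ((show (orderOf g).Coprime (p : ℕ) from hg).pow_right k) h1 hk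
    exact orderOf_eq_one_iff.1 h2
  let Λ : ∀ p, MonoidAlgebra ℤ (Quot_p G (P p)) →+* S := fun p =>
    (MonoidAlgebra.lift ℤ S _ (ψ.comp (QuotientGroup.lift _ _ (hker p)))).toRingHom
  have hform : ∀ y : MonoidAlgebra ℤ G, augmentation ℤ G y • (1 : S) - φ y =
      ∑ p, (augmentation ℤ G y • (1 : S) - Λ p (mapDomainRingHom ℤ
        (QuotientGroup.mk' (coprimeSubgroup G (P p))) y)) := by
    intro y
    induction y using MonoidAlgebra.induction_on with
    | of g =>
      have := hsum (g : H)
      simp only [hψ'] at this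
      simp only [augmentation_of, one_smul]
      have hg : ψ (g : H) = φ (of ℤ G g) := rfl
      rw [← hg, this]
      refine Finset.sum_congr rfl fun p _ => ?_
      simp only [Λ, AlgHom.toRingHom_eq_coe, RingHom.coe_coe, of_apply, mapDomainRingHom_apply,
        mapDomain_single, lift_single, one_smul]
      rfl
    | add a b ha hb =>
      simp only [map_add, add_smul, add_sub_add_comm, Finset.sum_add_distrib, ha, hb]
    | smul r a ha =>
      simp only [map_zsmul, smul_assoc, ← smul_sub, ← Finset.smul_sum, ha]
  have hε : augmentation ℤ G x = 0 := congrArg (fun z => (Subtype.val z).1) hx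
  have := hform x
  simpa [hε, mapDomain_mk_eq_zero_of_toPullback_eq_zero hx] using this

end Kernel

/-! ### Matrices over the group algebra of a `p`-group in characteristic `p` -/

section PGroup

/-- The norm element turns multiplication into the augmentation. -/
theorem mul_sum_of {H : Type*} [Group H] {R : Type*} [CommRing R] [Fintype H]
    (a : MonoidAlgebra R H) :
    a * ∑ h, of R H h = augmentation R H a • ∑ h, of R H h := by
  induction a using MonoidAlgebra.induction_on with
  | of g =>
    rw [augmentation_of, one_smul, Finset.mul_sum]
    exact Fintype.sum_equiv (Equiv.mulLeft g) _ _ fun h => (map_mul _ _ _).symm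
  | add a b ha hb => rw [add_mul, ha, hb, map_add, add_smul]
  | smul r a ha =>
    rw [smul_mul_assoc, ha, smul_smul]
    congr 1
    simp [augmentation]

theorem finite_monoidAlgebra {H : Type*} [Finite H] (R : Type*) [Semiring R] [Finite R] :
    Finite (MonoidAlgebra R H) :=
  Finite.of_injective (fun x h => x.coeff h) fun _ _ hxy =>
    MonoidAlgebra.coeff_injective (DFunLike.coe_injective hxy)

theorem eq_coeff_one_smul_sum_of {H : Type*} [Group H] {R : Type*} [CommRing R] [Fintype H]
    {a : MonoidAlgebra R H}
    (ha : ∀ h : H, a * of R H h = a) :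
    a = a.coeff 1 • ∑ h, of R H h := by
  have hcoeff : ∀ h, a.coeff h = a.coeff 1 := by
    intro h
    conv_rhs => rw [← ha h⁻¹, of_apply, coeff_mul_single_apply]
    simp
  conv_lhs => rw [← sum_coeff_single a, Finsupp.sum_fintype _ _ (fun h => single_zero h)]
  rw [Finset.smul_sum]
  refine Finset.sum_congr rfl fun h _ => ?_
  rw [hcoeff, of_apply, smul_single, smul_eq_mul, mul_one]

variable {p : ℕ} {H : Type*} [Group H] [Finite H]

/-- A nonzero group of vectors over `𝔽_p[H]`, where `H` is a `p`-group, that is stable under the right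
action of `H` contains a nonzero fixed vector: the numbers of vectors and of fixed vectors are
congruent modulo `p`. -/
theorem exists_forall_mul_of_eq_self [Fact p.Prime] (hH : IsPGroup p H) {n : ℕ}
    (X : AddSubgroup (Fin n → MonoidAlgebra (ZMod p) H))
    (hX : ∀ w ∈ X, ∀ h : H, (fun i => w i * of (ZMod p) H h) ∈ X)
    {v : Fin n → MonoidAlgebra (ZMod p) H} (hv : v ∈ X) (hv0 : v ≠ 0) :
    ∃ b ∈ X, b ≠ 0 ∧ ∀ i (h : H), b i * of (ZMod p) H h = b i := by
  have : Finite (MonoidAlgebra (ZMod p) H) := finite_monoidAlgebra _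
  let act : MulAction H X :=
    { smul := fun h w => ⟨fun i => w.1 i * of (ZMod p) H h⁻¹, hX _ w.2 _⟩
      one_smul := fun w => Subtype.ext (funext fun i => by
        show w.1 i * of (ZMod p) H 1⁻¹ = _
        rw [inv_one, map_one, mul_one])
      mul_smul := fun g h w => Subtype.ext (funext fun i => by
        show w.1 i * of (ZMod p) H (g * h)⁻¹ =
          w.1 i * of (ZMod p) H h⁻¹ * of (ZMod p) H g⁻¹
        rw [mul_inv_rev, map_mul, mul_assoc]) }
  have hsmul : ∀ (h : H) (w : X) i, (h • w).1 i = w.1 i * of (ZMod p) H h⁻¹ :=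
    fun _ _ _ => rfl
  have hdvd : p ∣ Nat.card X := by
    have hord : addOrderOf (⟨v, hv⟩ : X) = p := by
      refine addOrderOf_eq_prime (Subtype.ext ?_) fun h => hv0 (congrArg Subtype.val h)
      show p • v = 0
      ext1 i
      rw [Pi.smul_apply, ← Nat.cast_smul_eq_nsmul (ZMod p), CharP.cast_eq_zero, zero_smul]
      rfl
    exact hord.symm.dvd.trans (addOrderOf_dvd_natCard _)
  obtain ⟨b, hb, hb0⟩ := hH.exists_fixed_point_of_prime_dvd_card_of_fixed_point X hdvd
    (a := 0) (fun h => Subtype.ext (funext fun i => zero_mul _))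
  refine ⟨b.1, b.2, fun h => hb0 (Subtype.ext h.symm), fun i h => ?_⟩
  have := congrArg (fun w : X => w.1 i) (hb h⁻¹)
  simpa only [hsmul, inv_inv] using this

/-- The kernel of a matrix over `𝔽_p[H]`, where `H` is a `p`-group, is stable under the right
action of `H`, so if it is nonzero then it contains a nonzero fixed vector. The fixed vectors are
multiples of the norm element, on which the matrix acts through its augmentation. -/
theorem mulVec_eq_zero_of_isUnit_augmentation [Fact p.Prime] (hH : IsPGroup p H) {n : ℕ}
    {M : Matrix (Fin n) (Fin n) (MonoidAlgebra (ZMod p) H)}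
    (hM : IsUnit (M.map (augmentation (ZMod p) H))) {v : Fin n → MonoidAlgebra (ZMod p) H}
    (hv : M *ᵥ v = 0) : v = 0 := by
  have := Fintype.ofFinite H
  by_contra hv0
  let X : AddSubgroup (Fin n → MonoidAlgebra (ZMod p) H) :=
    { carrier := {w | M *ᵥ w = 0}
      add_mem' := fun {a b} ha hb => by
        show M *ᵥ (a + b) = 0
        rw [Matrix.mulVec_add, ha, hb, add_zero]
      zero_mem' := Matrix.mulVec_zero M
      neg_mem' := fun {a} ha => by
        show M *ᵥ (-a) = 0
        rw [Matrix.mulVec_neg, ha, neg_zero] }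
  obtain ⟨b, hbX, hb0, hb⟩ := exists_forall_mul_of_eq_self hH X (fun w hw h => by
    ext1 i
    have h := congrArg (· * of (ZMod p) H h) (congrFun hw i)
    simp only [Matrix.mulVec, dotProduct, Finset.sum_mul, mul_assoc, Pi.zero_apply,
      zero_mul] at h
    exact h) hv hv0
  set c : Fin n → ZMod p := fun i => (b i).coeff 1 with hcdef
  have hbc : ∀ i, b i = c i • ∑ h, of (ZMod p) H h := fun i => eq_coeff_one_smul_sum_of (hb i)
  have hMc : M.map (augmentation (ZMod p) H) *ᵥ c = 0 := by
    ext1 i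
    have h : ((M.map (augmentation (ZMod p) H) *ᵥ c) i) • ∑ h, of (ZMod p) H h = 0 := by
      have hi : ∑ j, M i j * b j = 0 := congrFun hbX i
      rw [← hi]
      simp only [Matrix.mulVec, dotProduct, Finset.sum_smul, Matrix.map_apply]
      refine Finset.sum_congr rfl fun j _ => ?_
      rw [hbc j, mul_smul_comm, mul_sum_of, smul_smul, mul_comm]
    have h1 := congrArg (fun y => y.coeff 1) h
    simpa [of_apply, coeff_sum, Finsupp.single_apply] using h1
  have hc : c = 0 := by
    obtain ⟨N, hN⟩ := hM.exists_left_inv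
    rw [← Matrix.one_mulVec c, ← hN, ← Matrix.mulVec_mulVec, hMc, Matrix.mulVec_zero]
  refine hb0 (funext fun i => ?_)
  rw [hbc i, hc, Pi.zero_apply, zero_smul, Pi.zero_apply]

/-- Left multiplication by such a matrix is injective, and the matrix ring is finite. -/
theorem isUnit_of_isUnit_augmentation_zmod [Fact p.Prime] (hH : IsPGroup p H) {n : ℕ}
    {M : Matrix (Fin n) (Fin n) (MonoidAlgebra (ZMod p) H)}
    (hM : IsUnit (M.map (augmentation (ZMod p) H))) : IsUnit M := by
  have : Finite (MonoidAlgebra (ZMod p) H) := finite_monoidAlgebra _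
  have : Finite (Matrix (Fin n) (Fin n) (MonoidAlgebra (ZMod p) H)) :=
    inferInstanceAs (Finite (Fin n → Fin n → MonoidAlgebra (ZMod p) H))
  refine IsLeftRegular.isUnit_of_finite fun Y Z hYZ => ?_
  rw [← sub_eq_zero]
  have h0 : M * (Y - Z) = 0 := by rw [mul_sub, sub_eq_zero]; exact hYZ
  ext1 i j
  exact (congrFun (mulVec_eq_zero_of_isUnit_augmentation hH hM
    (v := fun k => (Y - Z) k j) (funext fun k => congrFun (congrFun h0 k) j)) i)

end PGroup

/-! ### Matrices over the group algebra of a `p`-group over `ℤ_(p)` -/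

section Lifting

/-- Nakayama's lemma shows that multiplication by `1 + π y` is surjective. -/
theorem isUnit_one_add_smul {O E : Type*} [CommRing O] [IsLocalRing O] [Ring E] [Algebra O E]
    [Module.Finite O E] {π : O} (hπ : π ∈ IsLocalRing.maximalIdeal O) (y : E) :
    IsUnit (1 + π • y) := by
  have hright : ∀ y : E, ∃ r, (1 + π • y) * r = 1 := by
    intro y
    have htop : (⊤ : Submodule O E) ≤ LinearMap.range (LinearMap.mulLeft O (1 + π • y)) := by
      refine Submodule.le_of_le_smul_of_le_jacobson_bot (I := IsLocalRing.maximalIdeal O)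
        Module.Finite.fg_top (IsLocalRing.maximalIdeal_le_jacobson _) fun e _ => ?_
      have he : e = (1 + π • y) * e + π • (-(y * e)) := by
        rw [add_mul, one_mul, smul_neg, smul_mul_assoc, add_neg_cancel_right]
      rw [he]
      exact Submodule.add_mem_sup ⟨e, rfl⟩ (Submodule.smul_mem_smul hπ trivial)
    obtain ⟨r, hr⟩ := htop (Submodule.mem_top (x := 1))
    exact ⟨r, hr⟩
  obtain ⟨r, hr⟩ := hright y
  -- the right inverse `r` is again of the form `1 + π y'`, so it has a right inverse too
  have hr' : r = 1 + π • (-(y * r)) := by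
    rw [add_mul, one_mul, smul_mul_assoc] at hr
    rw [smul_neg, ← hr, add_neg_cancel_right]
  obtain ⟨t, ht⟩ := hright (-(y * r))
  rw [← hr'] at ht
  have : 1 + π • y = t := left_inv_eq_right_inv hr ht
  exact ⟨⟨1 + π • y, r, hr, by rw [this, ht]⟩, rfl⟩

theorem exists_eq_smul_of_mapRingHom_eq_zero {p : ℕ} [NeZero p] {H : Type*} [Group H]
    {x : MonoidAlgebra ℤ H}
    (hx : mapRingHom H (Int.castRingHom (ZMod p)) x = 0) : ∃ y, x = (p : ℤ) • y := by
  refine ⟨.ofCoeff (x.coeff.mapRange (· / (p : ℤ)) (Int.zero_ediv _)), ?_⟩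
  ext h
  have h0 := congrArg (fun y => y.coeff h) hx
  simp only [coeff_mapRingHom, coeff_zero, Finsupp.coe_zero, Pi.zero_apply, eq_intCast,
    ZMod.intCast_zmod_eq_zero_iff_dvd] at h0
  rw [coeff_smul, Finsupp.smul_apply, Finsupp.mapRange_apply, smul_eq_mul,
    Int.mul_ediv_cancel' h0]

theorem natCast_mem_maximalIdeal (p : Nat.Primes) :
    (((p : ℕ) : ℤ) : ZLoc p) ∈ IsLocalRing.maximalIdeal (ZLoc p) := by
  have h := (IsLocalization.AtPrime.to_map_mem_maximal_iff (ZLoc p)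
    (Ideal.span {((p : ℕ) : ℤ)}) ((p : ℕ) : ℤ)).2 (Ideal.mem_span_singleton_self _)
  simpa using h

/-- A matrix over `ℤ[H]`, where `H` is a `p`-group, with invertible augmentation is invertible
modulo `p`, and hence over `ℤ_(p)[H]` by Nakayama's lemma. -/
theorem isUnit_map_of_isUnit_augmentation (p : Nat.Primes) {H : Type*} [Group H] [Finite H]
    (hH : IsPGroup p H) {n : ℕ} {M : Matrix (Fin n) (Fin n) (MonoidAlgebra ℤ H)}
    (hM : IsUnit (M.map (augmentation ℤ H))) :
    IsUnit (M.map (mapRingHom H (algebraMap ℤ (ZLoc p)))) := by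
  have := Fact.mk p.2
  set r := mapRingHom H (Int.castRingHom (ZMod p)) with hr
  set f := mapRingHom H (algebraMap ℤ (ZLoc p)) with hf
  have hMr : IsUnit (M.map r) := by
    refine isUnit_of_isUnit_augmentation_zmod hH ?_
    have h1 : (augmentation (ZMod p) H).comp r =
        (Int.castRingHom (ZMod p)).comp (augmentation ℤ H) := by
      ext <;> simp [hr]
    rw [Matrix.map_map, ← RingHom.coe_comp, h1, RingHom.coe_comp, ← Matrix.map_map]
    exact hM.map (Int.castRingHom (ZMod p)).mapMatrix
  have hsurj : Function.Surjective r := MonoidAlgebra.map_surjective _ ZMod.intCast_surjective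
  choose s hs using hsurj
  have hlift : ∀ Y : Matrix (Fin n) (Fin n) (MonoidAlgebra ℤ H), Y.map r = 1 →
      IsUnit (Y.map f) := by
    intro Y hY
    have hentry : ∀ i j, ∃ y, (Y - 1) i j = ((p : ℕ) : ℤ) • y := by
      intro i j
      apply exists_eq_smul_of_mapRingHom_eq_zero
      have := congrFun (congrFun hY i) j
      rw [Matrix.map_apply] at this
      rw [Matrix.sub_apply, map_sub, this, Matrix.one_apply, Matrix.one_apply, apply_ite r,
        map_one, map_zero, sub_self]
    choose y hy using hentry
    have hYy : Y.map f = 1 + (((p : ℕ) : ℤ) : ZLoc p) • (Matrix.of y).map f := by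
      ext1 i j
      have h1 : Y i j = (1 : Matrix _ _ _) i j + ((p : ℕ) : ℤ) • y i j := by
        rw [← hy, Matrix.sub_apply, add_sub_cancel]
      rw [Matrix.map_apply, h1, map_add, map_zsmul, Matrix.add_apply, Matrix.smul_apply,
        Matrix.map_apply, Matrix.of_apply, Int.cast_smul_eq_zsmul, Matrix.one_apply,
        Matrix.one_apply, apply_ite f, map_one, map_zero]
    rw [hYy]
    exact isUnit_one_add_smul (natCast_mem_maximalIdeal p) _
  obtain ⟨N, hN1, hN2⟩ := isUnit_iff_exists.1 hMr
  have hNs : (N.map s).map r = N := by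
    ext1 i j
    exact hs _
  have h1 := hlift (M * N.map s) (by rw [Matrix.map_mul, hNs, hN1])
  have h2 := hlift (N.map s * M) (by rw [Matrix.map_mul, hNs, hN2])
  rw [Matrix.map_mul] at h1 h2
  obtain ⟨u, hu⟩ := h1.exists_right_inv
  obtain ⟨v, hv⟩ := h2.exists_left_inv
  exact isUnit_iff_exists_and_exists.2
    ⟨⟨(N.map s).map f * u, by rw [← mul_assoc, hu]⟩, ⟨v * (N.map s).map f, by rw [mul_assoc, hv]⟩⟩

end Lifting

/-! ### The quotients `G_p` -/

section Primary

variable {G : Type*} [Group G] [Finite G]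

/-- Every element of `G_p` is represented by an element of `p`-power order. -/
theorem exists_primary_representative (p : Nat.Primes) (x : Quot_p G p) :
    ∃ (g : G) (k : ℕ), g ^ (p : ℕ) ^ k = 1 ∧ (g : Quot_p G p) = x := by
  obtain ⟨g, rfl⟩ := QuotientGroup.mk_surjective x
  obtain ⟨a, m, hm, hgm⟩ := Nat.exists_eq_pow_mul_and_not_dvd (orderOf_pos g).ne' p p.2.ne_one
  have hco : ((p : ℕ) ^ a).Coprime m := ((Nat.Prime.coprime_iff_not_dvd p.2).2 hm).pow_left a
  -- `g ^ e` is the `p`-primary part of `g`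
  obtain ⟨e, he1, he0⟩ := Nat.chineseRemainder hco 1 0
  refine ⟨g ^ e, a, ?_, ?_⟩
  · rw [← pow_mul, ← orderOf_dvd_iff_pow_eq_one, hgm, mul_comm]
    exact Nat.mul_dvd_mul_right ((Nat.modEq_zero_iff_dvd).1 he0) _
  · refine QuotientGroup.eq.2 (Subgroup.subset_closure ?_)
    have hpow : ((g ^ e)⁻¹ * g) ^ m = 1 := by
      rw [(((Commute.refl g).pow_left e).inv_left).mul_pow, inv_pow, ← pow_mul,
        inv_mul_eq_one, pow_eq_pow_iff_modEq, hgm]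
      have := he1.mul_right' m
      rwa [one_mul] at this
    exact Nat.Coprime.coprime_dvd_left (orderOf_dvd_of_pow_eq_one hpow)
      ((Nat.Prime.coprime_iff_not_dvd p.2).2 hm).symm

theorem isPGroup_quot_p (p : Nat.Primes) : IsPGroup p (Quot_p G p) := by
  intro x
  obtain ⟨g, k, hg, rfl⟩ := exists_primary_representative p x
  exact ⟨k, by rw [← QuotientGroup.mk_pow, hg, QuotientGroup.mk_one]⟩

instance finite_primeIndex : Finite (PrimeIndex G) := by
  have h : ∀ p : PrimeIndex G, (p.1 : ℕ) ∈ (Nat.card G).primeFactors := by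
    rintro ⟨p, hp⟩
    have := Fact.mk p.2
    refine Nat.mem_primeFactors.2 ⟨p.2, ?_, Nat.card_pos.ne'⟩
    refine ((isPGroup_quot_p (G := G) p).card_eq_or_dvd.resolve_left ?_).trans
      (Subgroup.card_quotient_dvd_card _)
    exact Finite.one_lt_card.ne'
  exact Finite.of_injective (β := (Nat.card G).primeFactors) (fun p => ⟨p.1, h p⟩)
    fun p q hpq => Subtype.ext <| Subtype.ext <|
      congrArg (fun q : (Nat.card G).primeFactors => (q : ℕ)) hpq

end Primary

/-! ### Invertibility over the pullback -/

section Pullback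

variable (G : Type*) [Group G]

/-- The projection of the pullback to `ℤ`. -/
noncomputable def pullbackFst : pullbackRing G →+* ℤ :=
  (RingHom.fst _ _).comp (pullbackRing G).subtype

variable {G}

/-- The projection of the pullback to `ℤ_(p)[G_p]`. -/
noncomputable def pullbackSnd (p : PrimeIndex G) :
    pullbackRing G →+* MonoidAlgebra (ZLoc p.1) (Quot_p G p.1) :=
  (Pi.evalRingHom (fun p : PrimeIndex G => MonoidAlgebra (ZLoc p.1) (Quot_p G p.1)) p).comp
    ((RingHom.snd _ _).comp (pullbackRing G).subtype)

theorem pullbackSnd_apply (p : PrimeIndex G) (z : pullbackRing G) : pullbackSnd p z = z.1.2 p :=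
  rfl

theorem pullback_ext {z w : pullbackRing G} (h1 : pullbackFst G z = pullbackFst G w)
    (h2 : ∀ p, pullbackSnd p z = pullbackSnd p w) : z = w :=
  Subtype.ext (Prod.ext h1 (funext h2))

theorem augmentation_pullbackSnd (p : PrimeIndex G) (z : pullbackRing G) :
    augmentation (ZLoc p.1) (Quot_p G p.1) (pullbackSnd p z) =
      algebraMap ℤ (ZLoc p.1) (pullbackFst G z) :=
  (congrFun z.2 p).symm

theorem exists_pullback (k : ℤ)
    (x : ∀ p : PrimeIndex G, MonoidAlgebra (ZLoc p.1) (Quot_p G p.1))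
    (hx : ∀ p : PrimeIndex G,
      augmentation (ZLoc p.1) (Quot_p G p.1) (x p) = algebraMap ℤ (ZLoc p.1) k) :
    ∃ z : pullbackRing G, pullbackFst G z = k ∧
      ∀ p : PrimeIndex G, pullbackSnd p z = x p :=
  ⟨⟨(k, x), funext fun p => (hx p).symm⟩, rfl, fun p => pullbackSnd_apply p _⟩

theorem pullbackFst_toPullback (a : MonoidAlgebra ℤ G) :
    pullbackFst G (toPullback G a) = augmentation ℤ G a := rfl

theorem pullbackSnd_toPullback (p : PrimeIndex G) (a : MonoidAlgebra ℤ G) :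
    pullbackSnd p (toPullback G a) = toLocal G p.1 a := rfl

theorem isUnit_map_toLocal [Finite G] (p : Nat.Primes) {n : ℕ}
    {M : Matrix (Fin n) (Fin n) (MonoidAlgebra ℤ G)} (hM : IsUnit (M.map (augmentation ℤ G))) :
    IsUnit (M.map (toLocal G p)) := by
  rw [toLocal, RingHom.coe_comp, ← Matrix.map_map]
  refine isUnit_map_of_isUnit_augmentation p (isPGroup_quot_p p) ?_
  rwa [Matrix.map_map, ← RingHom.coe_comp, augmentation_comp_mapDomainRingHom]

/-- The inverses over `ℤ` and over the `ℤ_(p)[G_p]` agree over the `ℤ_(p)` by uniqueness of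
inverses, so they define an inverse over the pullback. -/
theorem inverts_toPullback [Finite G] :
    Inverts (invertedBy (augmentation ℤ G)) (toPullback G) := by
  intro m n M hM
  obtain ⟨N, hMN, hNM⟩ := hM
  obtain rfl : m = n := by
    simpa using Matrix.square_of_invertible _ _ hMN hNM
  have hU : ∀ p : PrimeIndex G, MatInvertible (M.map (toLocal G p.1)) := fun p =>
    isUnit_iff_matInvertible.1 (isUnit_map_toLocal p.1 (isUnit_iff_exists.2 ⟨N, hMN, hNM⟩))
  choose X hMX hXM using hU
  have hcompat : ∀ p : PrimeIndex G, (X p).map (augmentation (ZLoc p.1) (Quot_p G p.1)) =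
      N.map (algebraMap ℤ (ZLoc p.1)) := by
    intro p
    have h1 : (X p).map (augmentation (ZLoc p.1) (Quot_p G p.1)) *
        (M.map (toLocal G p.1)).map (augmentation (ZLoc p.1) (Quot_p G p.1)) = 1 := by
      rw [← Matrix.map_mul, hXM, Matrix.map_one _ (map_zero _) (map_one _)]
    have h2 : (M.map (augmentation ℤ G)).map (algebraMap ℤ (ZLoc p.1)) *
        N.map (algebraMap ℤ (ZLoc p.1)) = 1 := by
      rw [← Matrix.map_mul, hMN, Matrix.map_one _ (map_zero _) (map_one _)]
    have h3 : (M.map (toLocal G p.1)).map (augmentation (ZLoc p.1) (Quot_p G p.1)) =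
        (M.map (augmentation ℤ G)).map (algebraMap ℤ (ZLoc p.1)) := by
      ext1 i j
      exact augmentation_toLocal G p.1 _
    rw [h3] at h1
    exact left_inv_eq_right_inv h1 h2
  choose Y hY1 hY2 using fun i j => exists_pullback (N i j) (fun p => X p i j)
    fun p => congrFun (congrFun (hcompat p) i) j
  have hYN : (Matrix.of Y).map (pullbackFst G) = N := by
    ext1 i j
    exact hY1 i j
  have hYX : ∀ p, (Matrix.of Y).map (pullbackSnd p) = X p := by
    intro p
    ext1 i j
    exact hY2 i j p
  have hM1 : (M.map (toPullback G)).map (pullbackFst G) = M.map (augmentation ℤ G) := rfl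
  have hM2 : ∀ p, (M.map (toPullback G)).map (pullbackSnd p) = M.map (toLocal G p.1) :=
    fun p => rfl
  have hext : ∀ A B : Matrix (Fin m) (Fin m) (pullbackRing G),
      A.map (pullbackFst G) = B.map (pullbackFst G) →
      (∀ p, A.map (pullbackSnd p) = B.map (pullbackSnd p)) → A = B := by
    intro A B h1 h2
    ext1 i j
    exact pullback_ext (congrFun (congrFun h1 i) j) fun p => congrFun (congrFun (h2 p) i) j
  refine ⟨Matrix.of Y, hext _ _ ?_ fun p => ?_, hext _ _ ?_ fun p => ?_⟩
  · rw [Matrix.map_mul, hYN, hM1, hMN, Matrix.map_one _ (map_zero _) (map_one _)]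
  · rw [Matrix.map_mul, hYX, hM2, hMX, Matrix.map_one _ (map_zero _) (map_one _)]
  · rw [Matrix.map_mul, hYN, hM1, hNM, Matrix.map_one _ (map_zero _) (map_one _)]
  · rw [Matrix.map_mul, hYX, hM2, hXM, Matrix.map_one _ (map_zero _) (map_one _)]

end Pullback

/-! ### Elements of the pullback as fractions -/

section Fractions

variable {G : Type*} [Group G] [Finite G]

/-- An element of `G_p` is represented by an element of `p`-power order, which is trivial in the
other `G_q`. So every element of `ℤ[G_p]` lifts to `ℤ[G]` with constant image in the other
`ℤ[G_q]`. -/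
theorem exists_lift_quot (p : Nat.Primes) (b : MonoidAlgebra ℤ (Quot_p G p)) :
    ∃ a : MonoidAlgebra ℤ G, augmentation ℤ G a = augmentation ℤ _ b ∧
      mapDomainRingHom ℤ (QuotientGroup.mk' (coprimeSubgroup G p)) a = b ∧
      ∀ q, q ≠ p → mapDomainRingHom ℤ (QuotientGroup.mk' (coprimeSubgroup G q)) a =
        (augmentation ℤ _ b : ℤ) • 1 := by
  induction b using MonoidAlgebra.induction_on with
  | of x =>
    obtain ⟨g, k, hg, rfl⟩ := exists_primary_representative p x
    refine ⟨of ℤ G g, by simp, by simp, fun q hq => ?_⟩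
    have hgq : (g : Quot_p G q) = 1 := (QuotientGroup.eq_one_iff g).2 <| Subgroup.subset_closure <|
      Nat.Coprime.coprime_dvd_left (orderOf_dvd_of_pow_eq_one hg)
        (((Nat.coprime_primes p.2 q.2).2 fun h => hq (Subtype.ext h.symm)).pow_left k)
    simp [hgq, one_def]
  | add b c hb hc =>
    obtain ⟨a, h1, h2, h3⟩ := hb
    obtain ⟨a', h1', h2', h3'⟩ := hc
    refine ⟨a + a', by rw [map_add, map_add, h1, h1'], by rw [map_add, h2, h2'], fun q hq => ?_⟩
    rw [map_add, map_add, h3 q hq, h3' q hq, add_smul]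
  | smul r b hb =>
    obtain ⟨a, h1, h2, h3⟩ := hb
    refine ⟨r • a, by rw [map_zsmul, map_zsmul, h1], by rw [map_zsmul, h2], fun q hq => ?_⟩
    rw [map_zsmul, map_zsmul, h3 q hq, smul_assoc]

/-- The image of `ℤ[G]` in `∏ ℤ[G_p]` consists of the families with constant augmentation. -/
theorem exists_lift_pi (k : ℤ) (b : ∀ p : PrimeIndex G, MonoidAlgebra ℤ (Quot_p G p.1))
    (hb : ∀ p, augmentation ℤ _ (b p) = k) :
    ∃ a : MonoidAlgebra ℤ G, augmentation ℤ G a = k ∧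
      ∀ p : PrimeIndex G, mapDomainRingHom ℤ (QuotientGroup.mk' (coprimeSubgroup G p.1)) a =
        b p := by
  classical
  have := Fintype.ofFinite (PrimeIndex G)
  choose a h1 h2 h3 using fun p : PrimeIndex G => exists_lift_quot p.1 (b p)
  refine ⟨k • 1 + ∑ p, (a p - k • 1), ?_, fun q => ?_⟩
  · simp [h1, hb]
  · rw [map_add, map_sum, Finset.sum_eq_single q]
    · rw [map_sub, h2, add_sub_cancel]
    · intro p _ hpq
      rw [map_sub, h3 p q.1 fun h => hpq (Subtype.ext h.symm), hb, map_zsmul, map_one, sub_self]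
    · exact fun h => absurd (Finset.mem_univ q) h

/-- Elements of `ℤ_(p)[H]` have a common denominator prime to `p`. -/
theorem exists_common_denominator (p : Nat.Primes) {H : Type*} [Group H]
    (x : MonoidAlgebra (ZLoc p) H) : ∃ m : ℤ, ¬ ((p : ℕ) : ℤ) ∣ m ∧ ∃ b : MonoidAlgebra ℤ H,
      mapRingHom H (algebraMap ℤ (ZLoc p)) b = m * x := by
  induction x using MonoidAlgebra.induction_linear with
  | zero => exact ⟨1, (Nat.prime_iff_prime_int.1 p.2).not_dvd_one, 0, by simp⟩
  | add x y hx hy =>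
    obtain ⟨m, hm, b, hb⟩ := hx
    obtain ⟨m', hm', b', hb'⟩ := hy
    refine ⟨m * m', fun h => ((Nat.prime_iff_prime_int.1 p.2).dvd_or_dvd h).elim hm hm',
      m' * b + m * b', ?_⟩
    rw [map_add, map_mul, map_mul, hb, hb', map_intCast, map_intCast, Int.cast_mul, mul_add,
      mul_assoc, mul_assoc, ← mul_assoc (m' : MonoidAlgebra (ZLoc p) H),
      ← mul_assoc (m : MonoidAlgebra (ZLoc p) H) _ x, Int.cast_comm m']
  | single h r =>
    obtain ⟨⟨c, m⟩, hcm⟩ := IsLocalization.surj (Ideal.span {((p : ℕ) : ℤ)}).primeCompl r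
    refine ⟨m, fun h => m.2 (Ideal.mem_span_singleton.2 h), single h c, ?_⟩
    have hm : ((m : ℤ) : MonoidAlgebra (ZLoc p) H) = single 1 (algebraMap ℤ (ZLoc p) m) := by
      rw [← mapRingHom_single, ← map_intCast (mapRingHom H (algebraMap ℤ (ZLoc p))) (m : ℤ)]
      rfl
    rw [mapRingHom_single, ← hcm, hm, single_mul_single, one_mul, mul_comm r]

/-- The element `t = u m + v N`, where `N` is the norm element and `u m + v |G_p| = 1`, has
augmentation `1` and is central in `ℤ_(p)[G_p]`, and `x t` is integral. -/
theorem exists_local_denominator (p : Nat.Primes) (k : ℤ)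
    (x : MonoidAlgebra (ZLoc p) (Quot_p G p))
    (hx : augmentation (ZLoc p) (Quot_p G p) x = algebraMap ℤ (ZLoc p) k) :
    ∃ t b : MonoidAlgebra ℤ (Quot_p G p), augmentation ℤ _ t = 1 ∧ augmentation ℤ _ b = k ∧
      (∀ y, Commute (mapRingHom _ (algebraMap ℤ (ZLoc p)) t) y) ∧
      x * mapRingHom _ (algebraMap ℤ (ZLoc p)) t = mapRingHom _ (algebraMap ℤ (ZLoc p)) b := by
  have := Fintype.ofFinite (Quot_p G p)
  have := Fact.mk p.2
  obtain ⟨m, hm, b, hb⟩ := exists_common_denominator p x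
  have hco : IsCoprime m (Fintype.card (Quot_p G p) : ℤ) := by
    obtain ⟨n, hn⟩ := IsPGroup.iff_card.1 (isPGroup_quot_p (G := G) p)
    rw [← Nat.card_eq_fintype_card, hn, Nat.cast_pow]
    exact (((Nat.prime_iff_prime_int.1 p.2).coprime_iff_not_dvd.2 hm).symm).pow_right
  obtain ⟨u, v, huv⟩ := hco
  set f := mapRingHom (Quot_p G p) (algebraMap ℤ (ZLoc p)) with hf
  set N : MonoidAlgebra ℤ (Quot_p G p) := ∑ h, of ℤ _ h with hN
  have hfN : f N = ∑ h, of (ZLoc p) (Quot_p G p) h := by simp [hf, hN, map_sum]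
  have hNx : ∀ y, y * f N = augmentation _ _ y • f N := fun y => by rw [hfN, mul_sum_of]
  have hεN : augmentation ℤ _ N = Fintype.card (Quot_p G p) := by simp [hN]
  have hfNc : ∀ y, Commute (f N) y := by
    intro y
    rw [hfN]
    induction y using MonoidAlgebra.induction_on with
    | of g =>
      show _ * _ = _ * _
      rw [mul_sum_of, augmentation_of, one_smul, Finset.sum_mul]
      exact Fintype.sum_equiv (Equiv.mulRight g) _ _ fun h => (map_mul _ _ _).symm
    | add a b ha hb => exact ha.add_right hb
    | smul r a ha => exact ha.smul_right r
  have hxN : x * f N = k * f N := by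
    rw [hNx, hx, Algebra.smul_def, eq_intCast (algebraMap ℤ (ZLoc p)), map_intCast]
  refine ⟨(u * m : ℤ) + v * N, u * b + (v * k : ℤ) * N, ?_, ?_, fun y => ?_, ?_⟩
  · simpa [hεN] using huv
  · have hεb : augmentation ℤ _ b = m * k := by
      apply algebraMap_zLoc_injective p
      have h1 : (augmentation (ZLoc p) (Quot_p G p)).comp f =
          (algebraMap ℤ (ZLoc p)).comp (augmentation ℤ _) := by
        ext <;> simp [hf]
      have h2 := RingHom.congr_fun h1 b
      rw [RingHom.comp_apply, RingHom.comp_apply, hb, map_mul, map_intCast, hx] at h2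
      rw [← h2, map_mul, eq_intCast (algebraMap ℤ (ZLoc p)) m]
    rw [map_add, map_mul, map_mul, map_intCast, map_intCast, hεN, hεb]
    simp only [Int.cast_id]
    linear_combination k * huv
  · rw [map_add, map_mul, map_intCast, map_intCast]
    exact (Int.cast_commute _ y).add_left ((Int.cast_commute _ y).mul_left (hfNc y))
  · simp only [map_add, map_mul, map_intCast, hb]
    rw [mul_add, ← Int.cast_comm, Int.cast_mul, mul_assoc, ← mul_assoc x, ← Int.cast_comm,
      mul_assoc _ x, hxN, Int.cast_mul, mul_assoc _ (k : MonoidAlgebra (ZLoc p) (Quot_p G p))]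

theorem toLocal_apply {G : Type*} [Group G] (p : Nat.Primes) (a : MonoidAlgebra ℤ G) :
    toLocal G p a = mapRingHom _ (algebraMap ℤ (ZLoc p))
      (mapDomainRingHom ℤ (QuotientGroup.mk' (coprimeSubgroup G p)) a) := rfl

/-- Every element of the pullback is a fraction whose denominator is the image of an element of
augmentation `1` and is central in the pullback. -/
theorem exists_fraction (z : pullbackRing G) : ∃ a s : MonoidAlgebra ℤ G,
    augmentation ℤ G s = 1 ∧ (∀ w, Commute (toPullback G s) w) ∧
      z * toPullback G s = toPullback G a := by
  choose t b ht hb hc hz using fun p : PrimeIndex G =>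
    exists_local_denominator p.1 (pullbackFst G z) (pullbackSnd p z) (augmentation_pullbackSnd p z)
  obtain ⟨s, hs1, hs⟩ := exists_lift_pi 1 t ht
  obtain ⟨a, ha1, ha⟩ := exists_lift_pi (pullbackFst G z) b hb
  refine ⟨a, s, hs1, fun w => pullback_ext ?_ fun p => ?_, pullback_ext ?_ fun p => ?_⟩
  · rw [map_mul, map_mul, mul_comm]
  · rw [map_mul, map_mul, pullbackSnd_toPullback, toLocal_apply, hs]
    exact hc p _
  · rw [map_mul, pullbackFst_toPullback, pullbackFst_toPullback, hs1, ha1, mul_one]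
  · rw [map_mul, pullbackSnd_toPullback, pullbackSnd_toPullback, toLocal_apply, toLocal_apply,
      hs, ha, hz]

end Fractions

/-! ### Extension to a ring of fractions -/

section Universal

/-- If every element of `R` is a fraction of elements of `A` with central denominator, then a
homomorphism from `A` that kills the kernel of `A → R` and inverts the denominators extends
uniquely to `R`. -/
theorem existsUnique_extension {A R S : Type*} [Ring A] [Ring R] [Ring S] (ι : A →+* R)
    (φ : A →+* S) (D : Set A) (hD : ∀ s ∈ D, ∀ t ∈ D, s * t ∈ D)
    (hfrac : ∀ z : R, ∃ a, ∃ s ∈ D, z * ι s = ι a)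
    (hc : ∀ s ∈ D, ∀ w, Commute (ι s) w) (hunit : ∀ s ∈ D, IsUnit (φ s))
    (hker : ∀ a, ι a = 0 → φ a = 0) : ∃! h : R →+* S, h.comp ι = φ := by
  have hcongr : ∀ a b, ι a = ι b → φ a = φ b := fun a b hab => by
    rw [← sub_eq_zero, ← map_sub]
    exact hker _ (by rw [map_sub, hab, sub_self])
  have hcomm : ∀ s ∈ D, ∀ a, φ s * φ a = φ a * φ s := fun s hs a => by
    rw [← map_mul, ← map_mul]
    exact hcongr _ _ (by rw [map_mul, map_mul, (hc s hs _).eq])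
  have hex : ∀ z : R, ∃ y : S, ∀ a, ∀ s ∈ D, z * ι s = ι a → y * φ s = φ a := by
    intro z
    obtain ⟨a, s, hs, hz⟩ := hfrac z
    obtain ⟨u, hu⟩ := hunit s hs
    refine ⟨φ a * ↑u⁻¹, fun b t ht hzt => (hunit s hs).mul_right_cancel ?_⟩
    have hat : φ a * φ t = φ b * φ s := by
      rw [← map_mul, ← map_mul]
      exact hcongr _ _ (by rw [map_mul, map_mul, ← hz, ← hzt, mul_assoc, mul_assoc, (hc t ht _).eq])
    rw [mul_assoc, hcomm t ht s, ← mul_assoc, ← hu, Units.inv_mul_cancel_right, hat, hu]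
  -- `h z` is the common value of the fractions that represent `z`
  choose h hh using hex
  have huniq : ∀ z a, ∀ s ∈ D, ∀ y, z * ι s = ι a → y * φ s = φ a → h z = y :=
    fun z a s hs y hz hy => (hunit s hs).mul_right_cancel ((hh z a s hs hz).trans hy.symm)
  -- some denominator is needed to write the elements of the image of `A` as fractions
  obtain ⟨-, s₀, hs₀, -⟩ := hfrac 0
  have hι : ∀ a, h (ι a) = φ a := fun a =>
    huniq _ (a * s₀) s₀ hs₀ _ (map_mul _ _ _).symm (map_mul _ _ _).symm
  refine ⟨{ toFun := h, map_one' := ?_, map_mul' := ?_, map_zero' := ?_, map_add' := ?_ },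
    RingHom.ext hι, fun k hk => RingHom.ext fun z => ?_⟩
  · rw [← map_one ι, hι, map_one]
  · intro z w
    obtain ⟨a, s, hs, hz⟩ := hfrac z
    obtain ⟨b, t, ht, hw⟩ := hfrac w
    have hsw : φ s * h w = h w * φ s := by
      refine (hunit t ht).mul_right_cancel ?_
      rw [mul_assoc, hh w b t ht hw, mul_assoc, hcomm s hs t, ← mul_assoc, hh w b t ht hw,
        hcomm s hs b]
    refine huniq _ (a * b) (s * t) (hD s hs t ht) _ ?_ ?_
    · rw [map_mul, map_mul, ← hz, ← hw, mul_assoc z w, ← mul_assoc w, ← (hc s hs w).eq]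
      simp only [mul_assoc]
    · rw [map_mul, map_mul, ← hh z a s hs hz, ← hh w b t ht hw, mul_assoc (h z) (h w),
        ← mul_assoc (h w), ← hsw]
      simp only [mul_assoc]
  · rw [← map_zero ι, hι, map_zero]
  · intro z w
    obtain ⟨a, s, hs, hz⟩ := hfrac z
    obtain ⟨b, t, ht, hw⟩ := hfrac w
    refine huniq _ (a * t + b * s) (s * t) (hD s hs t ht) _ ?_ ?_
    · rw [map_mul, map_add, map_mul, map_mul, ← hz, ← hw, add_mul,
        mul_assoc w, (hc t ht (ι s)).eq, mul_assoc]
    · rw [map_mul, map_add, map_mul, map_mul, ← hh z a s hs hz, ← hh w b t ht hw, add_mul,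
        mul_assoc (h w), hcomm t ht s, mul_assoc]
  · obtain ⟨a, s, hs, hz⟩ := hfrac z
    refine (huniq z a s hs _ hz ?_).symm
    rw [← RingHom.congr_fun hk s, ← RingHom.congr_fun hk a, RingHom.comp_apply,
      RingHom.comp_apply, ← map_mul, hz]

end Universal

end Cohn

theorem theoremA (G : Type u) [Group G] [Finite G] :
    Cohn.IsCohnLocalization.{u, u, w}
      (Cohn.invertedBy (Cohn.augmentation ℤ G)) (Cohn.toPullback G) where
  inverts := Cohn.inverts_toPullback
  universal S _ φ hφ := by
    refine Cohn.existsUnique_extension (Cohn.toPullback G) φ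
      {s | Cohn.augmentation ℤ G s = 1 ∧ ∀ w, Commute (Cohn.toPullback G s) w} ?_ ?_
      (fun s hs => hs.2) (fun s hs => Cohn.isUnit_map_of_augmentation_eq_one hφ hs.1)
      (fun a => Cohn.map_eq_zero_of_toPullback_eq_zero hφ)
    · rintro s ⟨hs, hsc⟩ t ⟨ht, htc⟩
      exact ⟨by rw [map_mul, hs, ht, mul_one], fun w => by
        rw [map_mul]
        exact (hsc w).mul_left (htc w)⟩
    · intro z
      obtain ⟨a, s, hs, hsc, hz⟩ := Cohn.exists_fraction z
      exact ⟨a, s, ⟨hs, hsc⟩, hz⟩
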